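/- Let $d\ge 1$ be an integer, $\nu>1/2$ and $\ell>0$ real numbers, and let $\mathbb S^d=\{x\in\mathbb R^{d+1}:\|x\|_2=1\}$. Let \[ k(x,y)=\frac{2^{1-\nu}}{\Gamma(\nu)}\Big(\frac{\sqrt{2\nu}\,\|x-y\|_2}{\ell}\Big)^{\nu}K_\nu\Big(\frac{\sqrt{2\nu}\,\|x-y\|_2}{\ell}\Big)\quad (x\ne y),\qquad k(x,x)=1, \] be the Mat\'ern kernel restricted to $x,y\in\mathbb S^d$, where $K_\nu$ is the modified Bessel function of the second kind, $K_\nu(r)=\int_0^\infty e^{-r\cosh t}\cosh(\nu t)\,dt$ for $r>0$. Let $\tilde k:[-1,1]\to\mathbb R$ be the function with $k(x,y)=\tilde k(x^\top y)$ for all $x,y\in\mathbb S^d$. For an integer $m\ge 0$, the Mercer eigenvalue $\lambda_m$ of $k$, belonging to the spherical harmonics of degree $m$ on $\mathbb S^d$ (with respect to the surface measure), is \[ \lambda_m=|\mathbb S^{d-1}|\int_{-1}^1 P_{m,d+1}(t)\,\tilde k(t)\,(1-t^2)^{\frac{d-2}{2}}\,dt,\qquad |\mathbb S^{d-1}|=\frac{2\pi^{d/2}}{\Gamma(d/2)},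 \] where $P_{m,d+1}$ is the Legendre polynomial of degree $m$ in $d+1$ dimensions, \[ P_{m,d+1}(t)=m!\,\Gamma\Big(\frac d2\Big)\sum_{j=0}^{\lfloor m/2\rfloor}(-1)^j\frac{(1-t^2)^j\,t^{m-2j}}{4^j\,j!\,(m-2j)!\,\Gamma(j+\frac d2)}. \] Then, for every integer $m>2\nu$, \[ \lambda_m\le\frac{\tilde C_{d,\nu}}{\ell^{2\nu}}\,m^{-2\nu-d}, \] where \[ \tilde C_{d,\nu}=C_{d,\nu}\,\frac{\Gamma(2\nu+d)}{\Gamma\big(\nu+\frac{d+1}{2}\big)^2}\,\exp\Big(2\nu+d+\frac16\Big),\qquad C_{d,\nu}=\frac{2^{d+1}\pi^{(d+1)/2}\,\Gamma\big(\nu+\frac{d+1}{2}\big)(2\nu)^\nu}{\Gamma(\nu)}. \] -/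

import Mathlib

open Real

noncomputable section

/-- The modified Bessel function of the second kind `K_ν(x)`, for `x > 0`:
`K_ν(x) = ∫₀^∞ exp (-x cosh t) cosh (ν t) dt`. Only positive arguments are meaningful. -/
def besselK (ν x : ℝ) : ℝ :=
  ∫ t in Set.Ioi (0 : ℝ), Real.exp (-(x * Real.cosh t)) * Real.cosh (ν * t)

/-- The Matérn correlation at distance `r ≥ 0`, with smoothness `ν` and lengthscale `ℓ`.
At `r = 0`, where `K_ν` is infinite, it takes its limiting value `1`. -/
def maternProfile (ν ℓ r : ℝ) : ℝ :=
  if r = 0 then 1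
  else 2 ^ (1 - ν) / Real.Gamma ν * (√(2 * ν) * r / ℓ) ^ ν * besselK ν (√(2 * ν) * r / ℓ)

/-- The Matérn kernel on `ℝⁿ` with the Euclidean norm. -/
def maternKernel {n : ℕ} (ν ℓ : ℝ) (x y : EuclideanSpace ℝ (Fin n)) : ℝ :=
  maternProfile ν ℓ ‖x - y‖

/-- The surface area `|𝕊^{d-1}| = 2 π^{d/2} / Γ(d/2)` of the unit sphere of `ℝ^d`. -/
def unitSphereArea (d : ℕ) : ℝ :=
  2 * π ^ ((d : ℝ) / 2) / Real.Gamma ((d : ℝ) / 2)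

/-- The Legendre polynomial `P_{m,d+1}(t)` of degree `m` in `d + 1` dimensions. -/
def legendreDim (d m : ℕ) (t : ℝ) : ℝ :=
  (m.factorial : ℝ) * Real.Gamma ((d : ℝ) / 2) *
    ∑ k ∈ Finset.range (m / 2 + 1),
      (-1) ^ k * ((1 - t ^ 2) ^ k * t ^ (m - 2 * k)) /
        (4 ^ k * (k.factorial : ℝ) * ((m - 2 * k).factorial : ℝ) *
          Real.Gamma ((k : ℝ) + (d : ℝ) / 2))

/-- The Mercer eigenvalue `λ_m`, attached to the spherical harmonics of degree `m` on `𝕊^d`,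
of the dot-product kernel `(x, y) ↦ κ(xᵀ y)`:
`λ_m = |𝕊^{d-1}| ∫_{-1}^1 P_{m,d+1}(t) κ(t) (1 - t²)^{(d-2)/2} dt`. -/
def mercerEigenvalue (d : ℕ) (κ : ℝ → ℝ) (m : ℕ) : ℝ :=
  unitSphereArea d *
    ∫ t in (-1 : ℝ)..1, legendreDim d m t * κ t * (1 - t ^ 2) ^ (((d : ℝ) - 2) / 2)

/-- The constant `C_{d,ν}`. -/
def maternC (d : ℕ) (ν : ℝ) : ℝ :=
  2 ^ (d + 1) * π ^ (((d : ℝ) + 1) / 2) * Real.Gamma (ν + ((d : ℝ) + 1) / 2) * (2 * ν) ^ ν /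
    Real.Gamma ν

/-- The constant `C̃_{d,ν}`. -/
def maternCTilde (d : ℕ) (ν : ℝ) : ℝ :=
  maternC d ν * (Real.Gamma (2 * ν + d) / Real.Gamma (ν + ((d : ℝ) + 1) / 2) ^ 2) *
    Real.exp (2 * ν + d + 1 / 6)

/-- On the unit sphere the Matérn kernel is a dot-product kernel. -/
theorem maternKernel_eq_profile_inner {d : ℕ} (ν ℓ : ℝ)
    (x y : Metric.sphere (0 : EuclideanSpace ℝ (Fin (d + 1))) 1) :
    maternKernel ν ℓ (x : EuclideanSpace ℝ (Fin (d + 1))) y =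
      maternProfile ν ℓ (√(2 - 2 * inner ℝ (x : EuclideanSpace ℝ (Fin (d + 1))) y)) := by
  have hx : ‖(x : EuclideanSpace ℝ (Fin (d + 1)))‖ = 1 := by simp
  have hy : ‖(y : EuclideanSpace ℝ (Fin (d + 1)))‖ = 1 := by simp
  have h := norm_sub_sq_real (x : EuclideanSpace ℝ (Fin (d + 1))) y
  rw [hx, hy] at h
  rw [maternKernel, ← Real.sqrt_sq (norm_nonneg _), h]
  congr 2
  ring

end

/-! With a = ν/ℓ², the kernel profile is a Gamma mixture of the exponentials exp(-a(1-t)/s)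
(`maternProfile_sqrt_eq_integral`). Rodrigues' formula, i.e. m integrations by parts, turns the
Legendre integral of exp(xt) into (x/2)^m times the integral of the positive weight (1-t²)^(m+d/2-1)
against exp(xt) (`integral_legendreDim_mul_exp`).

With x = a/s the mixture integrand becomes nonnegative and gains s^(-m), so the damping exp(-s) can
be dropped without losing convergence. Tonelli then leaves an inverse-Gamma integral in s and a Beta
integral in t (`integral_mixture`), so the eigenvalue is at most an explicit constant times
Γ(m-ν)/Γ(m+ν+d). Log-convexity of Γ and m-ν ≥ m/2 bound this ratio by (m/2)^(-2ν-d)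
(`Gamma_sub_div_Gamma_add_le`). By Legendre duplication the resulting constant is C̃ without its
exponential factor, which is at least 1. -/

/-! ### Beta integrals on [0, 1] and [-1, 1]. -/

lemma intervalIntegrable_rpow_mul_one_sub_rpow {α β : ℝ} (hα : 0 < α) (hβ : 0 < β) :
    IntervalIntegrable (fun x : ℝ => x ^ (α - 1) * (1 - x) ^ (β - 1)) MeasureTheory.volume 0 1 := by
  have h := Complex.betaIntegral_convergent (u := α) (v := β) (by simpa) (by simpa)
  rw [intervalIntegrable_iff_integrableOn_Ioc_of_le zero_le_one] at h ⊢
  refine MeasureTheory.IntegrableOn.congr_fun h.re (fun x hx => ?_) measurableSet_Ioc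
  have h1 : (0 : ℝ) ≤ 1 - x := by linarith [hx.2]
  have h2 : ((x : ℂ) ^ ((α : ℂ) - 1) * (1 - (x : ℂ)) ^ ((β : ℂ) - 1)) =
      ((x ^ (α - 1) * (1 - x) ^ (β - 1) : ℝ) : ℂ) := by
    rw [Complex.ofReal_mul, Complex.ofReal_cpow hx.1.le, Complex.ofReal_cpow h1]
    push_cast
    rfl
  simp only [h2]
  exact Complex.ofReal_re _

lemma integral_rpow_mul_one_sub_rpow {α β : ℝ} (hα : 0 < α) (hβ : 0 < β) :
    ∫ x in (0 : ℝ)..1, x ^ (α - 1) * (1 - x) ^ (β - 1) =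
      Real.Gamma α * Real.Gamma β / Real.Gamma (α + β) := by
  have h := ProbabilityTheory.beta_eq_betaIntegralReal α β hα hβ
  rw [ProbabilityTheory.beta] at h
  rw [h, Complex.betaIntegral]
  have h2 : ∫ x in (0 : ℝ)..1, ((x : ℂ) ^ ((α : ℂ) - 1) * (1 - (x : ℂ)) ^ ((β : ℂ) - 1)) =
      ∫ x in (0 : ℝ)..1, ((x ^ (α - 1) * (1 - x) ^ (β - 1) : ℝ) : ℂ) := by
    refine intervalIntegral.integral_congr fun x hx => ?_
    rw [Set.uIcc_of_le zero_le_one] at hx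
    have h1 : (0 : ℝ) ≤ 1 - x := by linarith [hx.2]
    rw [Complex.ofReal_mul, Complex.ofReal_cpow hx.1, Complex.ofReal_cpow h1]
    push_cast
    rfl
  rw [h2, intervalIntegral.integral_ofReal, Complex.ofReal_re]

lemma one_add_rpow_mul_one_sub_rpow_eq {α β t : ℝ} (ht : t ∈ Set.Icc (-1 : ℝ) 1) :
    (1 + t) ^ (α - 1) * (1 - t) ^ (β - 1) =
      2 ^ (α + β - 2) * ((t / 2 + 1 / 2) ^ (α - 1) * (1 - (t / 2 + 1 / 2)) ^ (β - 1)) := by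
  have h1 : 1 + t = 2 * (t / 2 + 1 / 2) := by ring
  have h2 : 1 - t = 2 * (1 - (t / 2 + 1 / 2)) := by ring
  rw [h1, h2, mul_rpow zero_le_two (by linarith [ht.1]), mul_rpow zero_le_two (by linarith [ht.2]),
    show α + β - 2 = (α - 1) + (β - 1) by ring, rpow_add zero_lt_two]
  ring

lemma intervalIntegrable_one_add_rpow_mul_one_sub_rpow {α β : ℝ} (hα : 0 < α) (hβ : 0 < β) :
    IntervalIntegrable (fun t : ℝ => (1 + t) ^ (α - 1) * (1 - t) ^ (β - 1))
      MeasureTheory.volume (-1) 1 := by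
  have h := (intervalIntegrable_rpow_mul_one_sub_rpow hα hβ).comp_add_right (1 / 2)
  have h' := (h.comp_mul_left (c := 1 / 2)).const_mul (2 ^ (α + β - 2))
  norm_num at h'
  refine h'.congr fun t ht => ?_
  rw [Set.uIoc_of_le (by norm_num)] at ht
  rw [one_add_rpow_mul_one_sub_rpow_eq ⟨ht.1.le, ht.2⟩]
  ring_nf

lemma integral_one_add_rpow_mul_one_sub_rpow {α β : ℝ} (hα : 0 < α) (hβ : 0 < β) :
    ∫ t in (-1 : ℝ)..1, (1 + t) ^ (α - 1) * (1 - t) ^ (β - 1) =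
      2 ^ (α + β - 1) * (Real.Gamma α * Real.Gamma β / Real.Gamma (α + β)) := by
  rw [← integral_rpow_mul_one_sub_rpow hα hβ]
  have h : ∫ t in (-1 : ℝ)..1, (1 + t) ^ (α - 1) * (1 - t) ^ (β - 1) =
      ∫ t in (-1 : ℝ)..1, 2 ^ (α + β - 2) *
        ((t / 2 + 1 / 2) ^ (α - 1) * (1 - (t / 2 + 1 / 2)) ^ (β - 1)) := by
    refine intervalIntegral.integral_congr fun t ht => ?_
    rw [Set.uIcc_of_le (by norm_num)] at ht
    exact one_add_rpow_mul_one_sub_rpow_eq ht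
  rw [h, intervalIntegral.integral_const_mul,
    intervalIntegral.integral_comp_div_add (fun x : ℝ => x ^ (α - 1) * (1 - x) ^ (β - 1))
      two_ne_zero, show α + β - 1 = (α + β - 2) + 1 by ring, rpow_add_one two_ne_zero]
  norm_num
  ring

lemma one_sub_sq_rpow_eq {γ t : ℝ} (ht : t ∈ Set.Icc (-1 : ℝ) 1) :
    (1 - t ^ 2) ^ γ = (1 + t) ^ γ * (1 - t) ^ γ := by
  rw [← mul_rpow (by linarith [ht.1]) (by linarith [ht.2])]
  ring_nf

lemma intervalIntegrable_one_sub_sq_rpow {γ : ℝ} (hγ : -1 < γ) :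
    IntervalIntegrable (fun t : ℝ => (1 - t ^ 2) ^ γ) MeasureTheory.volume (-1) 1 := by
  have h := intervalIntegrable_one_add_rpow_mul_one_sub_rpow (α := γ + 1) (β := γ + 1)
    (by linarith) (by linarith)
  refine h.congr fun t ht => ?_
  rw [Set.uIoc_of_le (by norm_num)] at ht
  rw [one_sub_sq_rpow_eq ⟨ht.1.le, ht.2⟩]
  ring_nf

/-! ### Rodrigues' formula for weighted ultraspherical polynomials. -/

/-- The `k`-th summand of `weightedGegenbauer`. -/
noncomputable def weightedGegenbauerTerm (γ : ℝ) (j k : ℕ) (t : ℝ) : ℝ :=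
  if 2 * k ≤ j then
    (-1) ^ k * ((1 - t ^ 2) ^ (γ + k) * t ^ (j - 2 * k)) /
      (4 ^ k * (k.factorial : ℝ) * ((j - 2 * k).factorial : ℝ) * Real.Gamma (k + (γ + 1)))
  else 0

/-- The ultraspherical polynomial of degree `j` times its weight `(1 - t²)^γ`, normalised so that
it is `(-2)^{-j} / Γ(γ + j + 1)` times the `j`-th derivative of `(1 - t²)^(γ + j)`. -/
noncomputable def weightedGegenbauer (γ : ℝ) (j : ℕ) (t : ℝ) : ℝ :=
  (j.factorial : ℝ) * ∑ k ∈ Finset.range (j + 1), weightedGegenbauerTerm γ j k t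

lemma weightedGegenbauerTerm_of_lt {γ : ℝ} {j k : ℕ} (h : j < 2 * k) (t : ℝ) :
    weightedGegenbauerTerm γ j k t = 0 := if_neg (by omega)

/-- Differentiating the weight lowers its exponent and keeps the index k; differentiating the power
of t yields the summand of index k + 1. -/
lemma hasDerivAt_weightedGegenbauerTerm {γ t : ℝ} (hγ : -1 < γ) (ht : t ∈ Set.Ioo (-1 : ℝ) 1)
    (j k : ℕ) :
    HasDerivAt (weightedGegenbauerTerm (γ + 1) j k)
      (-2 * ((j : ℝ) + 1 - 2 * k) * weightedGegenbauerTerm γ (j + 1) k t +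
        -4 * ((k : ℝ) + 1) * weightedGegenbauerTerm γ (j + 1) (k + 1) t) t := by
  by_cases h : 2 * k ≤ j
  · obtain ⟨i, rfl⟩ := Nat.exists_eq_add_of_le h
    have hpos : 0 < 1 - t ^ 2 := by nlinarith [ht.1, ht.2]
    have hd1 : HasDerivAt (fun t : ℝ => 1 - t ^ 2) (-(2 * t)) t := by
      simpa using ((hasDerivAt_pow 2 t).const_sub 1)
    have hd2 := hd1.rpow_const (p := γ + 1 + k) (Or.inl hpos.ne')
    have hd3 := ((hd2.mul (hasDerivAt_pow i t)).const_mul ((-1 : ℝ) ^ k)).div_const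
      (4 ^ k * (k.factorial : ℝ) * (i.factorial : ℝ) * Real.Gamma (k + (γ + 1 + 1)))
    have hk : (k : ℝ) + (γ + 1) ≠ 0 := by
      have : (0 : ℝ) ≤ k := Nat.cast_nonneg k
      linarith
    have hG : Real.Gamma (k + (γ + 1 + 1)) = (k + (γ + 1)) * Real.Gamma (k + (γ + 1)) := by
      rw [← Real.Gamma_add_one hk, add_assoc (k : ℝ)]
    have hG0 : Real.Gamma (k + (γ + 1)) ≠ 0 := by
      refine (Real.Gamma_pos_of_pos ?_).ne'
      have : (0 : ℝ) ≤ k := Nat.cast_nonneg k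
      linarith
    have hf : weightedGegenbauerTerm (γ + 1) (2 * k + i) k = fun x =>
        (-1) ^ k * ((1 - x ^ 2) ^ (γ + 1 + k) * x ^ i) /
          (4 ^ k * k.factorial * i.factorial * Real.Gamma (k + (γ + 1 + 1))) := by
      funext x
      rw [weightedGegenbauerTerm, if_pos h, Nat.add_sub_cancel_left]
    rw [hf]
    refine hd3.congr_deriv ?_
    rw [weightedGegenbauerTerm, if_pos (by omega), show 2 * k + i + 1 - 2 * k = i + 1 by omega, hG,
      show γ + 1 + (k : ℝ) - 1 = γ + k by ring]
    have hr : (1 - t ^ 2) ^ (γ + 1 + k) = (1 - t ^ 2) ^ (γ + k) * (1 - t ^ 2) := by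
      rw [← rpow_add_one hpos.ne']
      ring_nf
    have hg : γ + 1 + k ≠ 0 := by rwa [add_comm] at hk
    have hi : (i : ℝ) + 1 ≠ 0 := by positivity
    -- For i = 0 the power of t is constant, matching the vanishing summand of index k + 1.
    rcases i with _ | i
    · rw [weightedGegenbauerTerm_of_lt (by omega), hr]
      push_cast [Nat.factorial]
      field_simp
      ring
    · rw [weightedGegenbauerTerm, if_pos (by omega),
        show 2 * k + (i + 1) + 1 - 2 * (k + 1) = i by omega]
      have hr' : (1 - t ^ 2) ^ (γ + ((k + 1 : ℕ) : ℝ)) = (1 - t ^ 2) ^ (γ + k) * (1 - t ^ 2) := by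
        rw [← rpow_add_one hpos.ne']
        push_cast
        ring_nf
      have hG' : Real.Gamma (((k + 1 : ℕ) : ℝ) + (γ + 1)) =
          (k + (γ + 1)) * Real.Gamma (k + (γ + 1)) := by
        rw [← hG]
        push_cast
        ring_nf
      have hi2 : (i : ℝ) + 1 ≠ 0 := by positivity
      rw [hr', hG', hr, Nat.add_sub_cancel]
      push_cast [Nat.factorial] at hi ⊢
      field_simp
      ring
  · have hf : weightedGegenbauerTerm (γ + 1) j k = fun _ => 0 :=
      funext fun x => weightedGegenbauerTerm_of_lt (by omega) x
    rw [hf]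
    refine (hasDerivAt_const t (0 : ℝ)).congr_deriv ?_
    rw [weightedGegenbauerTerm_of_lt (j := j + 1) (k := k + 1) (by omega)]
    -- Here the summand of degree j + 1 need not vanish, but its coefficient j + 1 - 2k does.
    by_cases h' : 2 * k = j + 1
    · have : (2 : ℝ) * k = j + 1 := by exact_mod_cast h'
      rw [this]
      ring
    · rw [weightedGegenbauerTerm_of_lt (by omega)]
      ring

/-- One step of Rodrigues' formula. After the index shift, summand k collects -2(j + 1 - 2k) - 4k =
-2(j + 1), independent of k, which promotes j! to (j + 1)!. -/
lemma hasDerivAt_weightedGegenbauer {γ t : ℝ} (hγ : -1 < γ) (ht : t ∈ Set.Ioo (-1 : ℝ) 1)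
    (j : ℕ) :
    HasDerivAt (weightedGegenbauer (γ + 1) j) (-2 * weightedGegenbauer γ (j + 1) t) t := by
  have h := (HasDerivAt.fun_sum fun k (_ : k ∈ Finset.range (j + 1)) =>
    hasDerivAt_weightedGegenbauerTerm hγ ht j k).const_mul (j.factorial : ℝ)
  refine h.congr_deriv ?_
  rw [weightedGegenbauer, Finset.sum_add_distrib]
  have h1 : ∑ k ∈ Finset.range (j + 1),
        -2 * ((j : ℝ) + 1 - 2 * k) * weightedGegenbauerTerm γ (j + 1) k t =
      ∑ k ∈ Finset.range (j + 1 + 1),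
        -2 * ((j : ℝ) + 1 - 2 * k) * weightedGegenbauerTerm γ (j + 1) k t := by
    rw [Finset.sum_range_succ _ (j + 1), weightedGegenbauerTerm_of_lt (k := j + 1) (by omega)]
    ring
  have h2 : ∑ k ∈ Finset.range (j + 1),
        -4 * ((k : ℝ) + 1) * weightedGegenbauerTerm γ (j + 1) (k + 1) t =
      ∑ k ∈ Finset.range (j + 1 + 1),
        -4 * (k : ℝ) * weightedGegenbauerTerm γ (j + 1) k t := by
    rw [Finset.sum_range_succ' _ (j + 1)]
    simp
  rw [h1, h2, ← Finset.sum_add_distrib, Finset.mul_sum, Finset.mul_sum, Finset.mul_sum]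
  refine Finset.sum_congr rfl fun k _ => ?_
  push_cast [Nat.factorial]
  ring

lemma weightedGegenbauerTerm_eq_zero_of_sq {γ t : ℝ} (hγ : 0 < γ) (ht : t ^ 2 = 1) (j k : ℕ) :
    weightedGegenbauerTerm γ j k t = 0 := by
  rw [weightedGegenbauerTerm, ht, sub_self, zero_rpow (by positivity)]
  simp

lemma weightedGegenbauer_eq_zero_of_sq {γ t : ℝ} (hγ : 0 < γ) (ht : t ^ 2 = 1) (j : ℕ) :
    weightedGegenbauer γ j t = 0 := by
  simp [weightedGegenbauer, weightedGegenbauerTerm_eq_zero_of_sq hγ ht]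

lemma continuous_weightedGegenbauer {γ : ℝ} (hγ : 0 ≤ γ) (j : ℕ) :
    Continuous (weightedGegenbauer γ j) := by
  refine continuous_const.mul (continuous_finsetSum _ fun k _ => ?_)
  unfold weightedGegenbauerTerm
  split_ifs
  · refine (continuous_const.mul (Continuous.mul ?_ (by fun_prop))).div_const _
    exact Continuous.rpow_const (by fun_prop) fun _ => Or.inr (by positivity)
  · exact continuous_const

lemma intervalIntegrable_weightedGegenbauer {γ : ℝ} (hγ : -1 < γ) (j : ℕ) :
    IntervalIntegrable (weightedGegenbauer γ j) MeasureTheory.volume (-1) 1 := by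
  refine IntervalIntegrable.const_mul ?_ _
  have h := IntervalIntegrable.sum (μ := MeasureTheory.volume) (a := -1) (b := 1)
    (f := fun k => weightedGegenbauerTerm γ j k) (Finset.range (j + 1)) fun k _ => ?_
  · simpa only [Finset.sum_fn] using h
  unfold weightedGegenbauerTerm
  split_ifs
  · refine (IntervalIntegrable.const_mul ?_ _).div_const _
    refine (intervalIntegrable_one_sub_sq_rpow ?_).mul_continuousOn (by fun_prop)
    have : (0 : ℝ) ≤ k := Nat.cast_nonneg k
    linarith
  · exact intervalIntegrable_const

/-- Integration by parts; the boundary terms vanish because the weight exponent γ + 1 is positive.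
-/
lemma integral_weightedGegenbauer_succ_mul_exp {γ : ℝ} (hγ : -1 < γ) (j : ℕ) (x : ℝ) :
    ∫ t in (-1 : ℝ)..1, weightedGegenbauer γ (j + 1) t * exp (x * t) =
      x / 2 * ∫ t in (-1 : ℝ)..1, weightedGegenbauer (γ + 1) j t * exp (x * t) := by
  have hcont := continuous_weightedGegenbauer (γ := γ + 1) (by linarith) j
  have hexp : Continuous fun t : ℝ => exp (x * t) := by fun_prop
  have hi1 : IntervalIntegrable (fun t => weightedGegenbauer γ (j + 1) t * exp (x * t))
      MeasureTheory.volume (-1) 1 :=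
    (intervalIntegrable_weightedGegenbauer hγ (j + 1)).mul_continuousOn hexp.continuousOn
  have hi2 : IntervalIntegrable (fun t => weightedGegenbauer (γ + 1) j t * exp (x * t))
      MeasureTheory.volume (-1) 1 := (hcont.mul hexp).intervalIntegrable _ _
  have h := intervalIntegral.integral_eq_sub_of_hasDerivAt_of_le
    (f := fun t => weightedGegenbauer (γ + 1) j t * exp (x * t))
    (f' := fun t => -2 * (weightedGegenbauer γ (j + 1) t * exp (x * t)) +
      x * (weightedGegenbauer (γ + 1) j t * exp (x * t)))
    (show (-1 : ℝ) ≤ 1 by norm_num) (hcont.mul hexp).continuousOn (fun t ht => by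
      have he : HasDerivAt (fun t : ℝ => exp (x * t)) (exp (x * t) * x) t := by
        simpa using ((hasDerivAt_id t).const_mul x).exp
      refine ((hasDerivAt_weightedGegenbauer hγ ht j).mul he).congr_deriv ?_
      ring) ((hi1.const_mul _).add (hi2.const_mul _))
  rw [intervalIntegral.integral_add (hi1.const_mul _) (hi2.const_mul _),
    intervalIntegral.integral_const_mul, intervalIntegral.integral_const_mul,
    weightedGegenbauer_eq_zero_of_sq (by linarith) (by norm_num),
    weightedGegenbauer_eq_zero_of_sq (by linarith) (by norm_num)] at h
  linarith

lemma integral_weightedGegenbauer_mul_exp {γ : ℝ} (hγ : -1 < γ) (j : ℕ) (x : ℝ) :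
    ∫ t in (-1 : ℝ)..1, weightedGegenbauer γ j t * exp (x * t) =
      (x / 2) ^ j / Real.Gamma (γ + j + 1) *
        ∫ t in (-1 : ℝ)..1, (1 - t ^ 2) ^ (γ + j) * exp (x * t) := by
  induction j generalizing γ with
  | zero =>
    rw [← intervalIntegral.integral_const_mul]
    refine intervalIntegral.integral_congr fun t _ => ?_
    simp [weightedGegenbauer, weightedGegenbauerTerm]
    ring
  | succ j ih =>
    rw [integral_weightedGegenbauer_succ_mul_exp hγ, ih (by linarith)]
    push_cast
    rw [show γ + 1 + (j : ℝ) = γ + (j + 1) by ring]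
    ring

lemma legendreDim_mul_rpow_eq_weightedGegenbauer (d m : ℕ) {t : ℝ}
    (ht : t ∈ Set.Ioo (-1 : ℝ) 1) :
    legendreDim d m t * (1 - t ^ 2) ^ (((d : ℝ) - 2) / 2) =
      Real.Gamma ((d : ℝ) / 2) * weightedGegenbauer (((d : ℝ) - 2) / 2) m t := by
  have hpos : 0 < 1 - t ^ 2 := by nlinarith [ht.1, ht.2]
  have hsub : Finset.range (m / 2 + 1) ⊆ Finset.range (m + 1) :=
    Finset.range_subset_range.2 (by omega)
  rw [legendreDim, weightedGegenbauer, ← Finset.sum_subset hsub fun k _ hk =>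
    weightedGegenbauerTerm_of_lt (by rw [Finset.mem_range] at hk; omega) t, mul_assoc,
    Finset.sum_mul, mul_comm (m.factorial : ℝ), mul_assoc]
  congr 2
  refine Finset.sum_congr rfl fun k hk => ?_
  rw [weightedGegenbauerTerm, if_pos (by rw [Finset.mem_range] at hk; omega), rpow_add hpos,
    rpow_natCast, show ((d : ℝ) - 2) / 2 + 1 = d / 2 by ring]
  ring

lemma integral_legendreDim_mul_exp {d : ℕ} (hd : 1 ≤ d) (m : ℕ) (x : ℝ) :
    ∫ t in (-1 : ℝ)..1, legendreDim d m t * (1 - t ^ 2) ^ (((d : ℝ) - 2) / 2) * exp (x * t) =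
      Real.Gamma ((d : ℝ) / 2) / Real.Gamma (m + (d : ℝ) / 2) * (x / 2) ^ m *
        ∫ t in (-1 : ℝ)..1, (1 - t ^ 2) ^ (m + (d : ℝ) / 2 - 1) * exp (x * t) := by
  have hd' : (1 : ℝ) ≤ d := by exact_mod_cast hd
  have h : ∫ t in (-1 : ℝ)..1,
        legendreDim d m t * (1 - t ^ 2) ^ (((d : ℝ) - 2) / 2) * exp (x * t) =
      ∫ t in (-1 : ℝ)..1, Real.Gamma ((d : ℝ) / 2) *
        (weightedGegenbauer (((d : ℝ) - 2) / 2) m t * exp (x * t)) := by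
    refine intervalIntegral.integral_congr_Ioo_of_le (by norm_num) fun t ht => ?_
    rw [legendreDim_mul_rpow_eq_weightedGegenbauer d m ht, mul_assoc]
  rw [h, intervalIntegral.integral_const_mul, integral_weightedGegenbauer_mul_exp (by linarith),
    show ((d : ℝ) - 2) / 2 + m = m + d / 2 - 1 by ring, sub_add_cancel]
  ring

/-! ### The Matérn profile as a Gamma mixture. -/

lemma integrableOn_rpow_mul_exp_neg_sub_div {ν c : ℝ} (hν : 0 < ν) (hc : 0 ≤ c) :
    MeasureTheory.IntegrableOn (fun s : ℝ => s ^ (ν - 1) * exp (-s - c / s)) (Set.Ioi 0) := by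
  refine MeasureTheory.Integrable.mono (Real.GammaIntegral_convergent hν)
    (Measurable.aestronglyMeasurable (by fun_prop)) ?_
  refine (MeasureTheory.ae_restrict_mem measurableSet_Ioi).mono fun s (hs : 0 < s) => ?_
  rw [norm_of_nonneg (by positivity), norm_of_nonneg (by positivity), mul_comm]
  gcongr
  have : 0 ≤ c / s := by positivity
  linarith

/-- The substitution s = (z/2) exp t gives the integral of exp(-z cosh t) exp(νt) over the whole
line; folding it at 0 produces cosh(νt). -/
lemma besselK_eq_integral_rpow_mul_exp {ν z : ℝ} (hν : 0 < ν) (hz : 0 < z) :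
    2 * (z / 2) ^ ν * besselK ν z =
      ∫ s in Set.Ioi (0 : ℝ), s ^ (ν - 1) * exp (-s - z ^ 2 / 4 / s) := by
  have himg : (fun t : ℝ => z / 2 * exp t) '' Set.univ = Set.Ioi 0 := by
    ext s
    simp only [Set.image_univ, Set.mem_range, Set.mem_Ioi]
    refine ⟨fun ⟨t, ht⟩ => ht ▸ by positivity, fun hs => ⟨log (s / (z / 2)), ?_⟩⟩
    rw [exp_log (by positivity)]
    field_simp
  have hder : ∀ t ∈ (Set.univ : Set ℝ),
      HasDerivWithinAt (fun t : ℝ => z / 2 * exp t) (z / 2 * exp t) Set.univ t :=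
    fun t _ => ((Real.hasDerivAt_exp t).const_mul _).hasDerivWithinAt
  have hinj : Set.InjOn (fun t : ℝ => z / 2 * exp t) Set.univ := fun x _ y _ h =>
    exp_injective (mul_left_cancel₀ (by positivity) h)
  have hfun : (fun t : ℝ => |z / 2 * exp t| • ((z / 2 * exp t) ^ (ν - 1) *
      exp (-(z / 2 * exp t) - z ^ 2 / 4 / (z / 2 * exp t)))) =
      fun t => (z / 2) ^ ν * (exp (-(z * cosh t)) * exp (ν * t)) := by
    funext t
    have h0 : 0 < z / 2 * exp t := by positivity
    have h1 : (z / 2 * exp t) * (z / 2 * exp t) ^ (ν - 1) = (z / 2) ^ ν * exp (ν * t) := by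
      rw [mul_comm, ← rpow_add_one h0.ne', sub_add_cancel, mul_rpow (by positivity) (by positivity),
        ← exp_mul, mul_comm t]
    have h2 : -(z / 2 * exp t) - z ^ 2 / 4 / (z / 2 * exp t) = -(z * cosh t) := by
      rw [cosh_eq, exp_neg]
      field_simp
      ring
    rw [abs_of_pos h0, smul_eq_mul, ← mul_assoc, h1, h2]
    ring
  have hint := (MeasureTheory.integrableOn_image_iff_integrableOn_abs_deriv_smul
    MeasurableSet.univ hder hinj
    (fun s : ℝ => s ^ (ν - 1) * exp (-s - z ^ 2 / 4 / s))).1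
    (himg ▸ integrableOn_rpow_mul_exp_neg_sub_div hν (by positivity))
  have heq := MeasureTheory.integral_image_eq_integral_abs_deriv_smul
    MeasurableSet.univ hder hinj (fun s : ℝ => s ^ (ν - 1) * exp (-s - z ^ 2 / 4 / s))
  rw [hfun, MeasureTheory.integrableOn_univ] at hint
  rw [himg, hfun, MeasureTheory.setIntegral_univ, MeasureTheory.integral_const_mul] at heq
  have hc : (z / 2) ^ ν ≠ 0 := by positivity
  have hint' : MeasureTheory.Integrable fun t : ℝ => exp (-(z * cosh t)) * exp (ν * t) := by
    simpa [hc] using (MeasureTheory.integrable_const_mul_iff (IsUnit.mk0 _ hc) _).1 hint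
  have hsplit : ∫ t : ℝ, exp (-(z * cosh t)) * exp (ν * t) = 2 * besselK ν z := by
    rw [← intervalIntegral.integral_Iic_add_Ioi hint'.integrableOn hint'.integrableOn (b := 0)]
    have hneg := integral_comp_neg_Ioi (0 : ℝ) fun t : ℝ => exp (-(z * cosh t)) * exp (ν * t)
    rw [neg_zero] at hneg
    have hI : MeasureTheory.IntegrableOn
        (fun t : ℝ => exp (-(z * cosh (-t))) * exp (ν * -t)) (Set.Ioi 0) :=
      hint'.comp_neg.integrableOn
    rw [← hneg, ← MeasureTheory.integral_add hI hint'.integrableOn, besselK,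
      ← MeasureTheory.integral_const_mul]
    congr 1
    funext t
    rw [cosh_neg, cosh_eq (ν * t)]
    ring_nf
  rw [heq, hsplit]
  ring

/-- The Matérn kernel as a Gamma mixture of Gaussian kernels. -/
lemma maternProfile_sqrt_eq_integral {ν ℓ t : ℝ} (hν : 0 < ν) (hℓ : 0 < ℓ) (ht : t < 1) :
    maternProfile ν ℓ √(2 - 2 * t) = 1 / Real.Gamma ν *
      ∫ s in Set.Ioi (0 : ℝ), s ^ (ν - 1) * exp (-s - ν / ℓ ^ 2 * (1 - t) / s) := by
  have hr : 0 < √(2 - 2 * t) := sqrt_pos.2 (by linarith)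
  have hz : 0 < √(2 * ν) * √(2 - 2 * t) / ℓ := by positivity
  have hz2 : (√(2 * ν) * √(2 - 2 * t) / ℓ) ^ 2 / 4 = ν / ℓ ^ 2 * (1 - t) := by
    rw [div_pow, mul_pow, sq_sqrt (by positivity), sq_sqrt (by linarith)]
    ring
  rw [maternProfile, if_neg hr.ne', ← hz2, ← besselK_eq_integral_rpow_mul_exp hν hz,
    div_rpow hz.le zero_le_two, rpow_sub zero_lt_two, rpow_one]
  have : (2 : ℝ) ^ ν ≠ 0 := by positivity
  field_simp

/-- Since d ≥ 1 there are two orthonormal vectors e and f, and t is the inner product of e with t e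
+ √(1-t²) f. -/
lemma eqOn_maternProfile_of_eq_inner {d : ℕ} (hd : 1 ≤ d) {ν ℓ : ℝ} {κ : ℝ → ℝ}
    (hκ : ∀ x y : Metric.sphere (0 : EuclideanSpace ℝ (Fin (d + 1))) 1,
      maternKernel ν ℓ (x : EuclideanSpace ℝ (Fin (d + 1))) y =
        κ (inner ℝ (x : EuclideanSpace ℝ (Fin (d + 1))) y)) :
    Set.EqOn κ (fun t => maternProfile ν ℓ √(2 - 2 * t)) (Set.Icc (-1) 1) := by
  intro t ht
  have hpos : 0 ≤ 1 - t ^ 2 := by nlinarith [ht.1, ht.2]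
  let i : Fin (d + 1) := 0
  let j : Fin (d + 1) := ⟨1, by omega⟩
  have hij : i ≠ j := by simp [i, j, Fin.ext_iff]
  let x : EuclideanSpace ℝ (Fin (d + 1)) := EuclideanSpace.single i 1
  let y : EuclideanSpace ℝ (Fin (d + 1)) :=
    t • EuclideanSpace.single i 1 + √(1 - t ^ 2) • EuclideanSpace.single j 1
  have hii (k : Fin (d + 1)) : inner ℝ (EuclideanSpace.single k (1 : ℝ))
      (EuclideanSpace.single k (1 : ℝ)) = (1 : ℝ) := by
    simp
  have hoff : inner ℝ (EuclideanSpace.single i (1 : ℝ))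
      (EuclideanSpace.single j (1 : ℝ)) = (0 : ℝ) := by
    simp [EuclideanSpace.inner_single_left, hij]
  have hoff' : inner ℝ (EuclideanSpace.single j (1 : ℝ))
      (EuclideanSpace.single i (1 : ℝ)) = (0 : ℝ) := by
    rw [real_inner_comm, hoff]
  have hx : ‖x‖ = 1 := by simp [x]
  have hxy : inner ℝ x y = t := by
    simp only [x, y, inner_add_right, inner_smul_right, hii, hoff]
    ring
  have hy : ‖y‖ = 1 := by
    have h : ‖y‖ ^ 2 = 1 := by
      rw [← real_inner_self_eq_norm_sq]
      simp only [y, inner_add_right, inner_add_left, inner_smul_right, inner_smul_left, hii, hoff,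
        hoff', conj_trivial]
      have := mul_self_sqrt hpos
      linear_combination this
    nlinarith [norm_nonneg y]
  have h := hκ ⟨x, by simpa using hx⟩ ⟨y, by simpa using hy⟩
  rw [maternKernel_eq_profile_inner] at h
  simpa only [hxy] using h.symm

/-- Logarithmic convexity of the Gamma function. -/
lemma rpow_mul_Gamma_le_Gamma_add {x c : ℝ} (hx : 0 < x) (hc : 1 ≤ c) :
    x ^ c * Real.Gamma x ≤ Real.Gamma (x + c) := by
  have hGx := Real.Gamma_pos_of_pos hx
  have hGc := Real.Gamma_pos_of_pos (show 0 < x + c by linarith)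
  have hc0 : 0 < c := by linarith
  -- The weights 1 - 1/c and 1/c make x + 1 a convex combination of x and x + c.
  have h := Real.convexOn_log_Gamma.2 (Set.mem_Ioi.2 hx)
    (Set.mem_Ioi.2 (show 0 < x + c by linarith))
    (show 0 ≤ 1 - 1 / c by rw [sub_nonneg, div_le_one hc0]; exact hc)
    (show 0 ≤ 1 / c by positivity) (by ring)
  have he : (1 - 1 / c) • x + (1 / c) • (x + c) = x + 1 := by
    simp only [smul_eq_mul]
    field_simp
    ring
  rw [he] at h
  simp only [Function.comp, smul_eq_mul, Real.Gamma_add_one hx.ne', log_mul hx.ne' hGx.ne'] at h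
  rw [← log_le_log_iff (by positivity) hGc, log_mul (by positivity) hGx.ne', log_rpow hx]
  have h2 := mul_le_mul_of_nonneg_left h hc0.le
  have h3 : c * ((1 - 1 / c) * log (Real.Gamma x) + 1 / c * log (Real.Gamma (x + c))) =
      (c - 1) * log (Real.Gamma x) + log (Real.Gamma (x + c)) := by
    field_simp
  rw [h3] at h2
  linarith

/-! ### The undamped mixture, evaluated by Tonelli. -/

lemma integrableOn_rpow_mul_exp_neg_div {p b : ℝ} (hp : 0 < p) (hb : 0 < b) :
    MeasureTheory.IntegrableOn (fun s : ℝ => s ^ (-p - 1) * exp (-b / s)) (Set.Ioi 0) := by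
  have h := integrableOn_rpow_mul_exp_neg_mul_rpow (p := 1) (s := p - 1) (b := b) (by linarith)
    zero_lt_one hb
  rw [← MeasureTheory.integrableOn_Ioi_comp_rpow_iff _ (neg_ne_zero.2 (one_ne_zero (α := ℝ)))] at h
  refine h.congr_fun (fun s (hs : 0 < s) => ?_) measurableSet_Ioi
  have h1 : s ^ (-p - 1) = s ^ ((-1 : ℝ) - 1) * s ^ (-1 * (p - 1)) := by
    rw [← rpow_add hs]
    ring_nf
  simp only [smul_eq_mul, abs_neg, abs_one, one_mul, rpow_one]
  rw [h1, ← rpow_mul hs.le, rpow_neg_one, mul_assoc]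
  ring_nf

/-- The substitution s ↦ 1/s reduces this to the Gamma integral. -/
lemma integral_rpow_mul_exp_neg_div {p b : ℝ} (hp : 0 < p) (hb : 0 < b) :
    ∫ s in Set.Ioi (0 : ℝ), s ^ (-p - 1) * exp (-b / s) = b ^ (-p) * Real.Gamma p := by
  have h := Real.integral_rpow_mul_exp_neg_mul_Ioi hp hb
  rw [← MeasureTheory.integral_comp_rpow_Ioi _ (neg_ne_zero.2 (one_ne_zero (α := ℝ))), one_div,
    inv_rpow hb.le, ← rpow_neg hb.le] at h
  rw [← h]
  refine MeasureTheory.setIntegral_congr_fun measurableSet_Ioi fun s (hs : 0 < s) => ?_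
  have h1 : s ^ (-p - 1) = s ^ ((-1 : ℝ) - 1) * s ^ (-1 * (p - 1)) := by
    rw [← rpow_add hs]
    ring_nf
  simp only [smul_eq_mul, abs_neg, abs_one, one_mul]
  rw [h1, ← rpow_mul hs.le, rpow_neg_one, mul_assoc]
  ring_nf

section Mixture

variable {α β a p : ℝ}

lemma integral_mixture_slice (hp : 0 < p) (ha : 0 < a) {t : ℝ} (ht : t ∈ Set.Ioo (-1 : ℝ) 1) :
    ∫ s in Set.Ioi (0 : ℝ), (1 - t ^ 2) ^ (α - 1) * (s ^ (-p - 1) * exp (-(a * (1 - t)) / s)) =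
      a ^ (-p) * Real.Gamma p * ((1 + t) ^ (α - 1) * (1 - t) ^ (α - p - 1)) := by
  have h1 : 0 < 1 - t := by linarith [ht.2]
  rw [MeasureTheory.integral_const_mul, integral_rpow_mul_exp_neg_div hp (by positivity),
    mul_rpow ha.le h1.le, one_sub_sq_rpow_eq ⟨ht.1.le, ht.2.le⟩,
    show α - p - 1 = (α - 1) + -p by ring, rpow_add h1]
  ring

/-- Integrating out s leaves a multiple of (1+t)^(α-1) (1-t)^(α-p-1), integrable because p < α. -/
lemma integrable_mixture (hp : 0 < p) (hpα : p < α) (ha : 0 < a) :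
    MeasureTheory.Integrable (fun q : ℝ × ℝ =>
      (1 - q.1 ^ 2) ^ (α - 1) * (q.2 ^ (-p - 1) * exp (-(a * (1 - q.1)) / q.2)))
      ((MeasureTheory.volume.restrict (Set.Ioo (-1) 1)).prod
        (MeasureTheory.volume.restrict (Set.Ioi 0))) := by
  rw [MeasureTheory.integrable_prod_iff (Measurable.aestronglyMeasurable (by fun_prop))]
  constructor
  · refine (MeasureTheory.ae_restrict_mem measurableSet_Ioo).mono fun t ht => ?_
    have h1 : 0 < 1 - t := by linarith [ht.2]
    exact MeasureTheory.Integrable.const_mul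
      (integrableOn_rpow_mul_exp_neg_div hp (show 0 < a * (1 - t) by positivity))
      ((1 - t ^ 2) ^ (α - 1))
  · have h := (intervalIntegrable_one_add_rpow_mul_one_sub_rpow (α := α) (β := α - p)
      (by linarith) (by linarith)).const_mul (a ^ (-p) * Real.Gamma p)
    rw [intervalIntegrable_iff_integrableOn_Ioo_of_le (by norm_num)] at h
    refine MeasureTheory.IntegrableOn.congr_fun h (fun t ht => ?_) measurableSet_Ioo
    rw [← integral_mixture_slice hp ha ht]
    refine MeasureTheory.setIntegral_congr_fun measurableSet_Ioi fun s (hs : 0 < s) => ?_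
    have h1 : 0 < 1 - t ^ 2 := by nlinarith [ht.1, ht.2]
    exact (norm_of_nonneg (by positivity)).symm

lemma integral_mixture (hp : 0 < p) (hpα : p < α) (ha : 0 < a) :
    ∫ s in Set.Ioi (0 : ℝ), ∫ t in Set.Ioo (-1 : ℝ) 1,
      (1 - t ^ 2) ^ (α - 1) * (s ^ (-p - 1) * exp (-(a * (1 - t)) / s)) =
      a ^ (-p) * Real.Gamma p * (2 ^ (α + (α - p) - 1) *
        (Real.Gamma α * Real.Gamma (α - p) / Real.Gamma (α + (α - p)))) := by
  rw [← MeasureTheory.integral_integral_swap (integrable_mixture hp hpα ha),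
    MeasureTheory.setIntegral_congr_fun measurableSet_Ioo fun t ht =>
      integral_mixture_slice hp ha ht, MeasureTheory.integral_const_mul,
    ← integral_one_add_rpow_mul_one_sub_rpow (by linarith) (by linarith),
    intervalIntegral.integral_of_le (by norm_num), MeasureTheory.integral_Ioc_eq_integral_Ioo]

end Mixture

/-! ### The Funk–Hecke integral of the mixture. -/

lemma continuous_legendreDim (d m : ℕ) : Continuous (legendreDim d m) := by
  unfold legendreDim
  fun_prop

lemma integrableOn_legendreDim_mul_rpow {d : ℕ} (hd : 1 ≤ d) (m : ℕ) :
    MeasureTheory.IntegrableOn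
      (fun t => legendreDim d m t * (1 - t ^ 2) ^ (((d : ℝ) - 2) / 2)) (Set.Ioo (-1) 1) := by
  have hd' : (1 : ℝ) ≤ d := by exact_mod_cast hd
  rw [← intervalIntegrable_iff_integrableOn_Ioo_of_le (by norm_num)]
  exact (intervalIntegrable_one_sub_sq_rpow (by linarith)).continuousOn_mul
    (continuous_legendreDim d m).continuousOn

/-- Bounding exp(-a(1-t)/s) by 1 gives an integrable product majorant, so Fubini applies although
the Legendre polynomial may change sign. -/
lemma integrable_legendreDim_mixture {d : ℕ} (hd : 1 ≤ d) (m : ℕ) {ν a : ℝ} (hν : 0 < ν)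
    (ha : 0 < a) :
    MeasureTheory.Integrable (fun q : ℝ × ℝ =>
      legendreDim d m q.1 * (1 - q.1 ^ 2) ^ (((d : ℝ) - 2) / 2) *
        (q.2 ^ (ν - 1) * exp (-q.2 - a * (1 - q.1) / q.2)))
      ((MeasureTheory.volume.restrict (Set.Ioo (-1) 1)).prod
        (MeasureTheory.volume.restrict (Set.Ioi 0))) := by
  have hL := (continuous_legendreDim d m).measurable
  refine ((integrableOn_legendreDim_mul_rpow hd m).mul_prod
    (Real.GammaIntegral_convergent hν)).mono (Measurable.aestronglyMeasurable (by fun_prop)) ?_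
  rw [MeasureTheory.Measure.prod_restrict]
  refine (MeasureTheory.ae_restrict_mem (measurableSet_Ioo.prod measurableSet_Ioi)).mono ?_
  rintro ⟨t, s⟩ ⟨ht, hs⟩
  replace hs : 0 < s := hs
  have h1 : 0 < 1 - t := by linarith [ht.2]
  rw [norm_mul, norm_mul _ (exp (-s) * _)]
  gcongr
  rw [norm_of_nonneg (by positivity), norm_of_nonneg (by positivity), mul_comm]
  gcongr
  have : 0 ≤ a * (1 - t) / s := by positivity
  linarith

/-- The Funk–Hecke integral of a Gaussian kernel, by Rodrigues' formula. -/
lemma integral_legendreDim_mixture_slice {d : ℕ} (hd : 1 ≤ d) (m : ℕ) (ν a : ℝ) {s : ℝ}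
    (hs : 0 < s) :
    ∫ t in Set.Ioo (-1 : ℝ) 1, legendreDim d m t * (1 - t ^ 2) ^ (((d : ℝ) - 2) / 2) *
        (s ^ (ν - 1) * exp (-s - a * (1 - t) / s)) =
      Real.Gamma ((d : ℝ) / 2) / Real.Gamma (m + (d : ℝ) / 2) * (a / 2) ^ m * (exp (-s) *
        ∫ t in Set.Ioo (-1 : ℝ) 1, (1 - t ^ 2) ^ (m + (d : ℝ) / 2 - 1) *
          (s ^ (-(m - ν) - 1) * exp (-(a * (1 - t)) / s))) := by
  have h := integral_legendreDim_mul_exp hd m (a / s)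
  rw [intervalIntegral.integral_of_le (by norm_num), MeasureTheory.integral_Ioc_eq_integral_Ioo,
    intervalIntegral.integral_of_le (by norm_num), MeasureTheory.integral_Ioc_eq_integral_Ioo] at h
  have h1 : ∀ t : ℝ, legendreDim d m t * (1 - t ^ 2) ^ (((d : ℝ) - 2) / 2) *
      (s ^ (ν - 1) * exp (-s - a * (1 - t) / s)) = s ^ (ν - 1) * (exp (-s) * exp (-a / s)) *
        (legendreDim d m t * (1 - t ^ 2) ^ (((d : ℝ) - 2) / 2) * exp (a / s * t)) := by
    intro t
    rw [show -s - a * (1 - t) / s = -s + -a / s + a / s * t by ring, exp_add, exp_add]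
    ring
  have h2 : ∀ t : ℝ, (1 - t ^ 2) ^ (m + (d : ℝ) / 2 - 1) *
      (s ^ (-(m - ν) - 1) * exp (-(a * (1 - t)) / s)) = s ^ (-(m - ν) - 1) * exp (-a / s) *
        ((1 - t ^ 2) ^ (m + (d : ℝ) / 2 - 1) * exp (a / s * t)) := by
    intro t
    rw [show -(a * (1 - t)) / s = -a / s + a / s * t by ring, exp_add]
    ring
  -- The factor s^(-m) comes from (x/2)^m at x = a/s.
  have h3 : s ^ (-(m - ν) - 1) = s ^ (ν - 1) / s ^ m := by
    rw [← rpow_natCast s m, ← rpow_sub hs]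
    ring_nf
  simp_rw [h1, h2]
  rw [MeasureTheory.integral_const_mul, MeasureTheory.integral_const_mul, h, h3, div_pow, div_pow,
    div_pow]
  ring

/-- Bound for the Funk–Hecke integral of the Matérn kernel: the factor `exp (-s)` of the mixing
density is dropped. -/
lemma integral_legendreDim_mixture_le {d : ℕ} (hd : 1 ≤ d) (m : ℕ) {ν a : ℝ} (hν : 0 < ν)
    (hm : ν < m) (ha : 0 < a) :
    ∫ t in Set.Ioo (-1 : ℝ) 1, ∫ s in Set.Ioi (0 : ℝ),
      legendreDim d m t * (1 - t ^ 2) ^ (((d : ℝ) - 2) / 2) *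
        (s ^ (ν - 1) * exp (-s - a * (1 - t) / s)) ≤
      Real.Gamma ((d : ℝ) / 2) * 2 ^ (ν + d - 1) * a ^ ν * Real.Gamma (ν + (d : ℝ) / 2) *
        (Real.Gamma (m - ν) / Real.Gamma (m + ν + d)) := by
  have hd' : (1 : ℝ) ≤ d := by exact_mod_cast hd
  have hm0 : (0 : ℝ) ≤ m := Nat.cast_nonneg m
  have hp : 0 < m - ν := by linarith
  have hpα : m - ν < m + (d : ℝ) / 2 := by linarith
  have hGd := Real.Gamma_pos_of_pos (show 0 < (d : ℝ) / 2 by positivity)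
  have hGα := Real.Gamma_pos_of_pos (show 0 < m + (d : ℝ) / 2 by positivity)
  have hint := (integrable_mixture hp hpα ha).integral_prod_right
  rw [MeasureTheory.integral_integral_swap (integrable_legendreDim_mixture hd m hν ha),
    MeasureTheory.setIntegral_congr_fun measurableSet_Ioi fun s hs =>
      integral_legendreDim_mixture_slice hd m ν a hs, MeasureTheory.integral_const_mul]
  have hle : ∫ s in Set.Ioi (0 : ℝ), exp (-s) *
        ∫ t in Set.Ioo (-1 : ℝ) 1, (1 - t ^ 2) ^ (m + (d : ℝ) / 2 - 1) *
          (s ^ (-(m - ν) - 1) * exp (-(a * (1 - t)) / s)) ≤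
      ∫ s in Set.Ioi (0 : ℝ), ∫ t in Set.Ioo (-1 : ℝ) 1, (1 - t ^ 2) ^ (m + (d : ℝ) / 2 - 1) *
          (s ^ (-(m - ν) - 1) * exp (-(a * (1 - t)) / s)) := by
    have hnn : ∀ s ∈ Set.Ioi (0 : ℝ), 0 ≤ ∫ t in Set.Ioo (-1 : ℝ) 1,
        (1 - t ^ 2) ^ (m + (d : ℝ) / 2 - 1) *
          (s ^ (-(m - ν) - 1) * exp (-(a * (1 - t)) / s)) := fun s (hs : 0 < s) => by
      refine MeasureTheory.setIntegral_nonneg measurableSet_Ioo fun t ht => ?_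
      have h1 : 0 < 1 - t ^ 2 := by nlinarith [ht.1, ht.2]
      positivity
    refine MeasureTheory.integral_mono_of_nonneg ?_ hint ?_
    · refine (MeasureTheory.ae_restrict_mem measurableSet_Ioi).mono fun s hs => ?_
      exact mul_nonneg (exp_pos _).le (hnn s hs)
    · refine (MeasureTheory.ae_restrict_mem measurableSet_Ioi).mono fun s hs => ?_
      exact mul_le_of_le_one_left (hnn s hs) (exp_le_one_iff.2 (neg_nonpos.2 (le_of_lt hs)))
  rw [integral_mixture hp hpα ha] at hle
  refine (mul_le_mul_of_nonneg_left hle (by positivity)).trans_eq ?_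
  -- The powers 2^m and a^m cancel against (a/2)^m, and Γ(m + d/2) cancels as well.
  rw [show m + (d : ℝ) / 2 - (m - ν) = ν + d / 2 by ring,
    show m + (d : ℝ) / 2 + (ν + d / 2) - 1 = (ν + d - 1) + m by ring,
    show m + (d : ℝ) / 2 + (ν + d / 2) = m + ν + d by ring,
    show -(m - ν) = ν - m by ring, rpow_add_natCast two_ne_zero, rpow_sub_natCast ha.ne', div_pow]
  field_simp

/-! ### The Gamma ratio, the constant, and the final bound. -/

lemma Gamma_sub_div_Gamma_add_le {m ν δ : ℝ} (hν : 1 / 2 < ν) (hδ : 0 ≤ δ) (hm : 2 * ν < m) :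
    Real.Gamma (m - ν) / Real.Gamma (m + ν + δ) ≤ 2 ^ (2 * ν + δ) * m ^ (-(2 * ν) - δ) := by
  have hx : 0 < m - ν := by linarith
  have hG := rpow_mul_Gamma_le_Gamma_add hx (show 1 ≤ 2 * ν + δ by linarith)
  rw [show m - ν + (2 * ν + δ) = m + ν + δ by ring] at hG
  -- This is where m > 2ν enters as m - ν ≥ m/2.
  have h2 : (m / 2) ^ (2 * ν + δ) ≤ (m - ν) ^ (2 * ν + δ) :=
    rpow_le_rpow (by linarith) (by linarith) (by linarith)
  have hm0 : 0 < m := by linarith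
  have hGx := Real.Gamma_pos_of_pos hx
  have hGy := Real.Gamma_pos_of_pos (show 0 < m + ν + δ by linarith)
  rw [show -(2 * ν) - δ = -(2 * ν + δ) by ring, rpow_neg hm0.le, ← div_eq_mul_inv,
    div_le_div_iff₀ hGy (by positivity)]
  rw [div_rpow hm0.le zero_le_two] at h2
  have h3 : (0 : ℝ) < 2 ^ (2 * ν + δ) := by positivity
  rw [div_le_iff₀ h3] at h2
  calc Real.Gamma (m - ν) * m ^ (2 * ν + δ)
      ≤ Real.Gamma (m - ν) * ((m - ν) ^ (2 * ν + δ) * 2 ^ (2 * ν + δ)) := by gcongr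
    _ = 2 ^ (2 * ν + δ) * ((m - ν) ^ (2 * ν + δ) * Real.Gamma (m - ν)) := by ring
    _ ≤ _ := by gcongr

/-- Legendre duplication at ν + d/2 removes Γ(2ν + d) and Γ(ν + (d+1)/2). -/
lemma maternCTilde_eq {d : ℕ} {ν : ℝ} (hν : 0 < ν) :
    maternCTilde d ν = 2 ^ d * π ^ ((d : ℝ) / 2) * (2 * ν) ^ ν / Real.Gamma ν *
      Real.Gamma (ν + (d : ℝ) / 2) * 2 ^ (2 * ν + d) * exp (2 * ν + d + 1 / 6) := by
  have hdup := Real.Gamma_mul_Gamma_add_half (ν + (d : ℝ) / 2)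
  rw [show ν + (d : ℝ) / 2 + 1 / 2 = ν + (d + 1) / 2 by ring,
    show 2 * (ν + (d : ℝ) / 2) = 2 * ν + d by ring,
    rpow_sub zero_lt_two, rpow_one] at hdup
  have hG1 := Real.Gamma_pos_of_pos (show 0 < ν + ((d : ℝ) + 1) / 2 by positivity)
  have hG2 := Real.Gamma_pos_of_pos hν
  have hπ : π ^ (((d : ℝ) + 1) / 2) = π ^ ((d : ℝ) / 2) * √π := by
    rw [sqrt_eq_rpow, ← rpow_add pi_pos]
    ring_nf
  have h2 : Real.Gamma (2 * ν + d) * √π = 2 ^ (2 * ν + d) / 2 *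
      (Real.Gamma (ν + (d : ℝ) / 2) * Real.Gamma (ν + (d + 1) / 2)) := by
    rw [hdup]
    field_simp
  rw [maternCTilde, maternC, hπ, pow_succ]
  generalize Real.Gamma (ν + (d : ℝ) / 2) = A at h2 ⊢
  generalize Real.Gamma (ν + ((d : ℝ) + 1) / 2) = B at h2 hG1 ⊢
  generalize Real.Gamma (2 * ν + d) = D at h2 ⊢
  field_simp
  linear_combination 2 * h2

theorem mainTheorem5 (d : ℕ) (hd : 1 ≤ d) (ν ℓ : ℝ) (hν : 1 / 2 < ν) (hℓ : 0 < ℓ)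
    (κ : ℝ → ℝ)
    (hκ : ∀ x y : Metric.sphere (0 : EuclideanSpace ℝ (Fin (d + 1))) 1,
      maternKernel ν ℓ (x : EuclideanSpace ℝ (Fin (d + 1))) y =
        κ (inner ℝ (x : EuclideanSpace ℝ (Fin (d + 1))) y))
    (m : ℕ) (hm : 2 * ν < (m : ℝ)) :
    mercerEigenvalue d κ m ≤
      maternCTilde d ν / ℓ ^ (2 * ν) * (m : ℝ) ^ (-(2 * ν) - (d : ℝ)) := by
  have hν0 : 0 < ν := by linarith
  have hm0 : (0 : ℝ) < m := by linarith
  have hd0 : (0 : ℝ) < d := by exact_mod_cast hd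
  have ha : 0 < ν / ℓ ^ 2 := by positivity
  have hGν := Real.Gamma_pos_of_pos hν0
  have hGd := Real.Gamma_pos_of_pos (show 0 < (d : ℝ) / 2 by positivity)
  have hGνd := Real.Gamma_pos_of_pos (show 0 < ν + (d : ℝ) / 2 by positivity)
  have hκ' := eqOn_maternProfile_of_eq_inner hd hκ
  have hint : ∫ t in (-1 : ℝ)..1,
        legendreDim d m t * κ t * (1 - t ^ 2) ^ (((d : ℝ) - 2) / 2) =
      1 / Real.Gamma ν * ∫ t in Set.Ioo (-1 : ℝ) 1, ∫ s in Set.Ioi (0 : ℝ),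
        legendreDim d m t * (1 - t ^ 2) ^ (((d : ℝ) - 2) / 2) *
          (s ^ (ν - 1) * exp (-s - ν / ℓ ^ 2 * (1 - t) / s)) := by
    rw [intervalIntegral.integral_of_le (by norm_num), MeasureTheory.integral_Ioc_eq_integral_Ioo,
      ← MeasureTheory.integral_const_mul]
    refine MeasureTheory.setIntegral_congr_fun measurableSet_Ioo fun t ht => ?_
    rw [hκ' ⟨ht.1.le, ht.2.le⟩, MeasureTheory.integral_const_mul,
      ← mul_assoc,
      mul_left_comm (1 / Real.Gamma ν), mul_assoc]
    simp only [maternProfile_sqrt_eq_integral hν0 hℓ ht.2]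
    ring
  have hle := (integral_legendreDim_mixture_le hd m hν0 (by linarith) ha).trans
    (mul_le_mul_of_nonneg_left (Gamma_sub_div_Gamma_add_le hν hd0.le hm) (by positivity))
  have haν : (ν / ℓ ^ 2) ^ ν = ν ^ ν / ℓ ^ (2 * ν) := by
    rw [div_rpow hν0.le (by positivity), ← rpow_natCast ℓ 2, ← rpow_mul hℓ.le]
    norm_num
  have h2 : (2 : ℝ) ^ (ν + d - 1) = 2 ^ ν * 2 ^ d / 2 := by
    rw [rpow_sub zero_lt_two, rpow_add zero_lt_two, rpow_natCast, rpow_one]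
  -- The exponential in C̃ is pure slack: the bound already holds with 1 in its place.
  have hexp : 1 ≤ exp (2 * ν + d + 1 / 6) := one_le_exp (by positivity)
  rw [mercerEigenvalue, hint, unitSphereArea, maternCTilde_eq hν0]
  refine (mul_le_mul_of_nonneg_left (mul_le_mul_of_nonneg_left hle (by positivity))
    (by positivity)).trans ?_
  calc _ = 2 ^ d * π ^ ((d : ℝ) / 2) * (2 * ν) ^ ν / Real.Gamma ν *
          Real.Gamma (ν + (d : ℝ) / 2) * 2 ^ (2 * ν + d) * 1 / ℓ ^ (2 * ν) *
            (m : ℝ) ^ (-(2 * ν) - (d : ℝ)) := by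
        rw [haν, h2, mul_rpow zero_le_two hν0.le]
        field_simp
    _ ≤ _ := by gcongr
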